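/- Let $(\Omega,\mathcal F,P)$ be a probability space, and let $\Lambda$ be the complete lattice of all sub-$\sigma$-fields of $\mathcal F$ containing all $P$-null events, ordered by inclusion; its least element $0$ is the $\sigma$-field generated by the null events, and its greatest element is $1=\mathcal F$. Give $\Lambda$ the topology in which $x_i\to x$ means that $Q_{x_i}\psi\to Q_x\psi$ in norm for every $\psi\in L_2(\Omega,\mathcal F,P)$, where $Q_x$ is the orthogonal projection of $L_2(\Omega,\mathcal F,P)$ onto its subspace of $x$-measurable elements (the conditional expectation given $x$). Let $B\subset\Lambda$ be a noise-type Boolean algebra: a distributive sublattice of $\Lambda$ containing $0$ and $1$, in which every element $x$ has a (necessarily unique) complement $x'\in B$, that is, $x\wedge x'=0$ and $x\vee x'=1$, and in which $x\wedge y=0$ implies that the $\sigma$-fields $x$ and $y$ are independent. Let $\operatorname{Cl}(B)$ be the closure of $B$ in $\Lambda$, and let $C$ be the noise-type completion of $B$, that is, the greatest noise-type Boolean algebra satisfying $B\subset C\subset\operatorname{Cl}(B)$ (equivalently, the union of all noise-type Boolean algebras between $B$ and $\operatorname{Cl}(B)$). For $x\in\Lambda$ and a sequence $(x_n)_n$ in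 $B$, write $x_n\uparrow x$ if $x_1\le x_2\le\dots$ and $\sup_n x_n=x$. Let $x\in\Lambda$ be such that $x_n\uparrow x$ for some $x_n\in B$ (so that $x \in \operatorname{Cl}(B)$). Then the following five conditions on $x$ are equivalent (the existence of the limits being part of the conditions): (a) $x\in C$; (b) $x\vee\lim_n x_n'=1$ for some $x_n\in B$ satisfying $x_n\uparrow x$; (c) $x\vee\lim_n x_n'=1$ for all $x_n\in B$ satisfying $x_n\uparrow x$; (d) $\lim_m\lim_n(x_m\vee x_n')=1$ for some $x_n\in B$ satisfying $x_n\uparrow x$; (e) $\lim_m\lim_n(x_m\vee x_n')=1$ for all $x_n\in B$ satisfying $x_n\uparrow x$. -/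

import Mathlib

open MeasureTheory ProbabilityTheory Filter Topology

namespace Noise

variable {Ω : Type*} {m0 : MeasurableSpace Ω}

/-- The trivial sigma-field, generated by the `P`-null events. -/
def nullField (P : Measure Ω) : MeasurableSpace Ω :=
  MeasurableSpace.generateFrom {s | MeasurableSet[m0] s ∧ P s = 0}

theorem nullField_le (P : Measure Ω) : nullField P ≤ m0 :=
  MeasurableSpace.generateFrom_le fun _ hs => hs.1

theorem nullField_le_iff (P : Measure Ω) (m : MeasurableSpace Ω) :
    nullField P ≤ m ↔ ∀ s, MeasurableSet[m0] s → P s = 0 → MeasurableSet[m] s := by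
  rw [nullField, MeasurableSpace.generateFrom_le_iff]
  exact ⟨fun h s h1 h2 => h ⟨h1, h2⟩, fun h s hs => h s hs.1 hs.2⟩

/-- The lattice `Λ` of all sub-sigma-fields of `m0` that contain all `P`-null events, ordered by
inclusion. Its bottom is the trivial sigma-field, its top is `m0`, meets are intersections and
joins are generated sigma-fields. -/
def Fields (P : Measure Ω) : Type _ := Set.Icc (nullField P) m0

namespace Fields

variable {P : Measure Ω}

noncomputable instance : CompleteLattice (Fields P) :=
  haveI : Fact (nullField P ≤ m0) := ⟨nullField_le P⟩
  inferInstanceAs (CompleteLattice (Set.Icc (nullField P) m0))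

/-- The underlying sigma-field `ℱ_x` of an element `x` of `Λ`. -/
def field (x : Fields P) : MeasurableSpace Ω := x.1

theorem field_le (x : Fields P) : x.field ≤ m0 := x.2.2

theorem le_iff (x y : Fields P) : x ≤ y ↔ x.field ≤ y.field := Iff.rfl

theorem field_bot : (⊥ : Fields P).field = nullField P := rfl

theorem field_top : (⊤ : Fields P).field = m0 := rfl

theorem field_inf (x y : Fields P) : (x ⊓ y).field = x.field ⊓ y.field := rfl

theorem field_sup (x y : Fields P) : (x ⊔ y).field = x.field ⊔ y.field := rfl

/-- The projection `Q_x` of `L₂(Ω, ℱ, P)` onto the subspace of `ℱ_x`-measurable elements, that is,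
the conditional expectation given `ℱ_x`. -/
noncomputable def Q (x : Fields P) (ψ : Lp ℝ 2 P) : Lp ℝ 2 P :=
  (condExpL2 ℝ ℝ x.field_le ψ : Lp ℝ 2 P)

/-- The topology of `Λ`: the strong operator topology of the projections, so that `x_i → x` if and
only if `Q_{x_i} ψ → Q_x ψ` in `L₂` for every `ψ`. -/
noncomputable instance : TopologicalSpace (Fields P) :=
  TopologicalSpace.induced (Q : Fields P → Lp ℝ 2 P → Lp ℝ 2 P) Pi.topologicalSpace

theorem tendsto_iff {ι : Type*} {l : Filter ι} (f : ι → Fields P) (x : Fields P) :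
    Tendsto f l (𝓝 x) ↔ ∀ ψ, Tendsto (fun i => (f i).Q ψ) l (𝓝 (x.Q ψ)) := by
  rw [nhds_induced, tendsto_comap_iff, tendsto_pi_nhds]
  rfl

end Fields

variable {P : Measure Ω}

/-- A noise-type Boolean algebra of sigma-fields: a sublattice of `Λ` containing `0` and `1` that is
a Boolean algebra (distributive and complemented) and in which disjoint elements are
independent. -/
structure IsNoiseType (B : Set (Fields P)) : Prop where
  bot_mem : ⊥ ∈ B
  top_mem : ⊤ ∈ B
  inf_mem : ∀ x ∈ B, ∀ y ∈ B, x ⊓ y ∈ B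
  sup_mem : ∀ x ∈ B, ∀ y ∈ B, x ⊔ y ∈ B
  distrib : ∀ x ∈ B, ∀ y ∈ B, ∀ z ∈ B, x ⊓ (y ⊔ z) = (x ⊓ y) ⊔ (x ⊓ z)
  exists_compl : ∀ x ∈ B, ∃ y ∈ B, x ⊓ y = ⊥ ∧ x ⊔ y = ⊤
  indep : ∀ x ∈ B, ∀ y ∈ B, x ⊓ y = ⊥ → Indep x.field y.field P

open Classical in
/-- The complement `x'` of `x` in `B` (the value `⊥` is returned if there is none; in a noise-type
Boolean algebra every element has exactly one complement). -/
noncomputable def compl (B : Set (Fields P)) (x : Fields P) : Fields P :=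
  if h : ∃ y ∈ B, x ⊓ y = ⊥ ∧ x ⊔ y = ⊤ then h.choose else ⊥

theorem IsNoiseType.compl_spec {B : Set (Fields P)} (hB : IsNoiseType B) {x : Fields P}
    (hx : x ∈ B) : compl B x ∈ B ∧ x ⊓ compl B x = ⊥ ∧ x ⊔ compl B x = ⊤ := by
  rw [compl, dif_pos (hB.exists_compl x hx)]
  exact (hB.exists_compl x hx).choose_spec

theorem IsNoiseType.eq_compl {B : Set (Fields P)} (hB : IsNoiseType B) {x y : Fields P}
    (hx : x ∈ B) (hy : y ∈ B) (h0 : x ⊓ y = ⊥) (h1 : x ⊔ y = ⊤) : y = compl B x := by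
  obtain ⟨hz, hz0, hz1⟩ := hB.compl_spec hx
  have e1 := hB.distrib y hy x hx _ hz
  have e2 := hB.distrib _ hz x hx y hy
  rw [hz1, inf_top_eq, inf_comm y x, h0, bot_sup_eq] at e1
  rw [h1, inf_top_eq, inf_comm _ x, hz0, bot_sup_eq, inf_comm] at e2
  exact e1.trans e2.symm

/-- The noise-type completion of `B`, the greatest noise-type Boolean algebra `D` satisfying
`B ⊆ D ⊆ Cl(B)`, written without choice as the union of all such `D`. -/
def completion (B : Set (Fields P)) : Set (Fields P) :=
  ⋃₀ {D | IsNoiseType D ∧ B ⊆ D ∧ D ⊆ closure B}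

theorem completion_eq_of_isGreatest {B C : Set (Fields P)}
    (h : IsGreatest {D | IsNoiseType D ∧ B ⊆ D ∧ D ⊆ closure B} C) : completion B = C :=
  subset_antisymm (Set.sUnion_subset fun _ hD => h.2 hD) (Set.subset_sUnion_of_mem h.1)

/-- The sequence `u` in `B` increases to `x`. -/
def IncreasesTo (B : Set (Fields P)) (u : ℕ → Fields P) (x : Fields P) : Prop :=
  (∀ n, u n ∈ B) ∧ Monotone u ∧ ⨆ n, u n = x

/-- `x ∨ lim_n u_n' = 1`, including the existence of the limit. -/
def JoinLimComplEqTop (B : Set (Fields P)) (u : ℕ → Fields P) (x : Fields P) : Prop :=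
  ∃ z, Tendsto (fun n => compl B (u n)) atTop (𝓝 z) ∧ x ⊔ z = ⊤

/-- `lim_m lim_n (u_m ∨ u_n') = 1`, including the existence of all the limits. -/
def IteratedLimEqTop (B : Set (Fields P)) (u : ℕ → Fields P) : Prop :=
  ∃ w : ℕ → Fields P, (∀ m, Tendsto (fun n => u m ⊔ compl B (u n)) atTop (𝓝 (w m))) ∧
    Tendsto w atTop (𝓝 ⊤)

end Noise

/-!
Let `u` increase to `x` and let `z = lim uₙ'`. The sequence `uₙ'` decreases, so the limit exists
and is `⨅ uₙ'`, and `z` is independent of `x`. All conditions are shown to be equivalent to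
`x ∨ z = 1`.

For the iterated limit, `u_m ∨ uₙ' → u_m ∨ z` as `n → ∞`, because the σ-fields `u_m` and
`u_m' ≥ uₙ'` are independent and generate everything, so that `L₂` is spanned by products `F ⊗ G` with `F`
measurable in `u_m` and `G` measurable in `u_m'`, and the projection acts on them factorwise
(`Fields.Q_tensor`). Then `u_m ∨ z` increases to `x ∨ z`.

If `x` lies in some noise-type Boolean algebra `D` with `B ⊆ D ⊆ Cl(B)`, its complement in `D` is
below every `uₙ'`, hence below `z`, and `x ∨ z = 1` (`IncreasesTo.sup_eq_top`).

Conversely, if `x ∨ z = 1`, then `D = {(b ∧ x) ∨ (c ∧ z) : b, c ∈ B}` is a noise-type Boolean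
algebra containing `B` and `x` and contained in `Cl(B)` (`IncreasesTo.mem_completion`). Here `L₂` is
spanned by the products `F ⊗ G` with `F` measurable in some `u_m` and `G` measurable in `z`, and on
each of them the projections for `(b ∧ uₙ) ∨ (c ∧ uₙ')` and for `(b ∧ x) ∨ (c ∧ z)` agree when
`n ≥ m`. So the former σ-fields, which belong to `B`, converge to the latter
(`IncreasesTo.tendsto_split`), and for `b = c` they are all equal to `b`, whence
`b = (b ∧ x) ∨ (b ∧ z)`. The lattice operations of `D` are then computed componentwise from the
rule `(a₁ ∨ c₁) ∧ (a₂ ∨ c₂) = (a₁ ∧ a₂) ∨ (c₁ ∧ c₂)` (`Fields.sup_inf_sup`), valid for `aᵢ ≤ x` and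
`cᵢ ≤ z` with commuting projections. Independence of disjoint elements of `D` comes for free,
because σ-fields with commuting projections and trivial intersection are independent
(`Fields.Commuting.indep`).
-/

namespace Noise

open scoped InnerProductSpace

variable {Ω : Type*} {m0 : MeasurableSpace Ω} {P : Measure Ω}

namespace Fields

/-! ### Projections onto spaces of measurable elements -/

/-- The closed subspace of `L₂` formed by the `ℱ_x`-measurable elements. -/
noncomputable def space (x : Fields P) : Submodule ℝ (Lp ℝ 2 P) := lpMeas ℝ ℝ x.field 2 P

instance (x : Fields P) : CompleteSpace (space x) :=
  haveI : Fact (x.field ≤ m0) := ⟨x.field_le⟩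
  inferInstanceAs (CompleteSpace (lpMeas ℝ ℝ x.field 2 P))

theorem Q_eq_starProjection (x : Fields P) (ψ : Lp ℝ 2 P) : x.Q ψ = x.space.starProjection ψ := rfl

/-- A function that is almost everywhere equal to an `ℱ_x`-measurable one is itself
`ℱ_x`-measurable, because `ℱ_x` contains the null events. -/
theorem measurable_of_ae_eq (x : Fields P) {f g : Ω → ℝ} (hf : Measurable[m0] f)
    (hg : Measurable[x.field] g) (h : f =ᵐ[P] g) : Measurable[x.field] f := by
  intro s hs
  -- `f ⁻¹' s` and `g ⁻¹' s` differ by a null event.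
  have hnull := (nullField_le_iff P x.field).1 x.2.1
  have h0 : P {ω | f ω ≠ g ω} = 0 := h
  have hgm : Measurable[m0] g := hg.mono x.field_le le_rfl
  have e : f ⁻¹' s = (g ⁻¹' s \ ({ω | f ω ≠ g ω} ∩ (g ⁻¹' s))) ∪
      ({ω | f ω ≠ g ω} ∩ (f ⁻¹' s)) := by
    ext ω
    by_cases hω : f ω = g ω <;> simp [hω]
  have hne : MeasurableSet[m0] {ω | f ω ≠ g ω} := (measurableSet_eq_fun hf hgm).compl
  rw [e]
  refine MeasurableSet.union (MeasurableSet.diff (hg hs) (hnull _ ?_ ?_)) (hnull _ ?_ ?_)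
  · exact hne.inter (hgm hs)
  · exact measure_mono_null (fun ω hω => hω.1) h0
  · exact hne.inter (hf hs)
  · exact measure_mono_null (fun ω hω => hω.1) h0

theorem mem_space_iff {x : Fields P} {ψ : Lp ℝ 2 P} : ψ ∈ x.space ↔ Measurable[x.field] ψ := by
  rw [space, mem_lpMeas_iff_aestronglyMeasurable]
  refine ⟨fun h => ?_, fun h => ?_⟩
  · exact measurable_of_ae_eq x (Lp.stronglyMeasurable ψ).measurable
      h.stronglyMeasurable_mk.measurable h.ae_eq_mk
  · exact h.stronglyMeasurable.aestronglyMeasurable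

theorem mem_space_of_ae_eq {x : Fields P} {ψ : Lp ℝ 2 P} {g : Ω → ℝ}
    (hg : Measurable[x.field] g) (h : ψ =ᵐ[P] g) : ψ ∈ x.space :=
  mem_space_iff.2 (measurable_of_ae_eq x (Lp.stronglyMeasurable ψ).measurable hg h)

theorem Q_mem (x : Fields P) (ψ : Lp ℝ 2 P) : x.Q ψ ∈ x.space := (condExpL2 ℝ ℝ x.field_le ψ).2

theorem Q_eq_self_iff {x : Fields P} {ψ : Lp ℝ 2 P} : x.Q ψ = ψ ↔ ψ ∈ x.space := by
  rw [Q_eq_starProjection, Submodule.starProjection_eq_self_iff]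

theorem norm_Q_le (x : Fields P) (ψ : Lp ℝ 2 P) : ‖x.Q ψ‖ ≤ ‖ψ‖ :=
  norm_condExpL2_coe_le x.field_le ψ

theorem space_mono {x y : Fields P} (h : x ≤ y) : x.space ≤ y.space := fun _ hψ =>
  mem_space_iff.2 ((mem_space_iff.1 hψ).mono h le_rfl)

theorem space_inf (x y : Fields P) : (x ⊓ y).space = x.space ⊓ y.space := by
  ext ψ
  rw [Submodule.mem_inf, mem_space_iff, mem_space_iff, mem_space_iff]
  exact ⟨fun h => ⟨fun s hs => (h hs).1, fun s hs => (h hs).2⟩, fun h s hs => ⟨h.1 hs, h.2 hs⟩⟩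

theorem field_iInf {ι : Type*} [Nonempty ι] (u : ι → Fields P) :
    (⨅ i, u i).field = ⨅ i, (u i).field := by
  refine le_antisymm (le_iInf fun i => (le_iff _ _).1 (iInf_le u i)) ?_
  let w : Fields P := ⟨⨅ i, (u i).field, le_iInf fun i => (u i).2.1,
    (iInf_le _ (Classical.arbitrary ι)).trans (field_le _)⟩
  exact (le_iff w _).1 (le_iInf fun i => (le_iff _ _).2 (iInf_le (fun i => (u i).field) i))

theorem field_iSup {ι : Type*} [Nonempty ι] (u : ι → Fields P) :
    (⨆ i, u i).field = ⨆ i, (u i).field := by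
  refine le_antisymm ?_ (iSup_le fun i => (le_iff _ _).1 (le_iSup u i))
  let w : Fields P := ⟨⨆ i, (u i).field, (u (Classical.arbitrary ι)).2.1.trans
    (le_iSup (fun i => (u i).field) _), iSup_le fun i => field_le _⟩
  exact (le_iff _ w).1 (iSup_le fun i => (le_iff _ _).2 (le_iSup (fun i => (u i).field) i))

theorem space_iInf {ι : Type*} [Nonempty ι] (u : ι → Fields P) :
    (⨅ i, u i).space = ⨅ i, (u i).space := by
  ext ψ
  simp only [Submodule.mem_iInf, mem_space_iff]
  refine ⟨fun h i => h.mono (iInf_le u i) le_rfl, fun h s hs => ?_⟩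
  rw [field_iInf, MeasurableSpace.measurableSet_iInf]
  exact fun i => h i hs

/-- The projections `Q_x` and `Q_y` commute. -/
def Commuting (x y : Fields P) : Prop := ∀ ψ, x.Q (y.Q ψ) = y.Q (x.Q ψ)

theorem Commuting.symm {x y : Fields P} (h : Commuting x y) : Commuting y x := fun ψ => (h ψ).symm

theorem Q_Q_of_ge {x y : Fields P} (h : x ≤ y) (ψ : Lp ℝ 2 P) : y.Q (x.Q ψ) = x.Q ψ :=
  Q_eq_self_iff.2 (space_mono h (Q_mem x ψ))

/-- The projection `Q_x` as a continuous linear map. -/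
noncomputable def proj (x : Fields P) : Lp ℝ 2 P →L[ℝ] Lp ℝ 2 P := x.space.starProjection

theorem proj_apply (x : Fields P) (ψ : Lp ℝ 2 P) : x.proj ψ = x.Q ψ := rfl

/-- The reverse martingale convergence theorem in `L₂`. -/
theorem tendsto_atTop_iInf {u : ℕ → Fields P} (hu : Antitone u) :
    Tendsto u atTop (𝓝 (⨅ n, u n)) := by
  rw [tendsto_iff]
  intro ψ
  have hclosed : (⨆ n, (u n).spaceᗮ).topologicalClosure = (⨅ n, u n).spaceᗮ := by
    rw [← Submodule.orthogonal_orthogonal_eq_closure, ← Submodule.iInf_orthogonal, space_iInf]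
    simp_rw [Submodule.orthogonal_orthogonal]
  have := Submodule.starProjection_tendsto_closure_iSup (fun n => (u n).spaceᗮ)
    (fun i j hij => Submodule.orthogonal_le (space_mono (hu hij))) ψ
  simp only [hclosed, Submodule.starProjection_orthogonal_val] at this
  simpa [Q_eq_starProjection] using (tendsto_const_nhds (x := ψ)).sub this

theorem commuting_of_tendsto {b x : Fields P} {u : ℕ → Fields P} (h : ∀ n, Commuting b (u n))
    (hu : Tendsto u atTop (𝓝 x)) : Commuting b x := fun ψ => by
  rw [tendsto_iff] at hu
  have h1 : Tendsto (fun n => b.proj ((u n).Q ψ)) atTop (𝓝 (b.proj (x.Q ψ))) :=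
    (b.proj.continuous.tendsto _).comp (hu ψ)
  exact tendsto_nhds_unique h1 ((hu (b.Q ψ)).congr fun n => (h n ψ).symm)

/-! ### Products of functions of independent σ-fields -/

theorem indepFun_of_measurable {m₁ m₂ : MeasurableSpace Ω} (h : Indep m₁ m₂ P) {f g : Ω → ℝ}
    (hf : Measurable[m₁] f) (hg : Measurable[m₂] g) : IndepFun f g P := by
  rw [IndepFun_iff_Indep]
  exact indep_of_indep_of_le h hf.comap_le hg.comap_le

/-- The pointwise product of two elements of `L₂`, meant for factors measurable with respect to
independent σ-fields. The value is `0` if the product is not square integrable. -/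
noncomputable def tensor (F G : Lp ℝ 2 P) : Lp ℝ 2 P :=
  open Classical in
  if h : MemLp (fun ω => F ω * G ω) 2 P then h.toLp _ else 0

theorem tensor_ae_eq {x z : Fields P} (h : Indep x.field z.field P) {F G : Lp ℝ 2 P}
    (hF : F ∈ x.space) (hG : G ∈ z.space) :
    tensor F G =ᵐ[P] fun ω => F ω * G ω := by
  have hm : MemLp (fun ω => F ω * G ω) 2 P := by
    refine (memLp_two_iff_integrable_sq
      ((Lp.aestronglyMeasurable F).mul (Lp.aestronglyMeasurable G))).2 ?_
    have hi := IndepFun.integrable_mul (indepFun_of_measurable h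
      ((mem_space_iff.1 hF).pow_const 2) ((mem_space_iff.1 hG).pow_const 2))
      (Lp.memLp F).integrable_sq (Lp.memLp G).integrable_sq
    refine hi.congr (ae_of_all _ fun ω => ?_)
    simp [mul_pow]
  rw [tensor, dif_pos hm]
  exact hm.coeFn_toLp

theorem setIntegral_tensor {x z : Fields P} (h : Indep x.field z.field P) {F G : Lp ℝ 2 P}
    (hF : F ∈ x.space) (hG : G ∈ z.space)
    {s t : Set Ω} (hs : MeasurableSet[x.field] s) (ht : MeasurableSet[z.field] t) :
    ∫ ω in s ∩ t, tensor F G ω ∂P = (∫ ω in s, F ω ∂P) * ∫ ω in t, G ω ∂P := by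
  have hs' := x.field_le s hs
  have ht' := z.field_le t ht
  rw [integral_congr_ae (ae_restrict_of_ae (tensor_ae_eq h hF hG)),
    ← integral_indicator (hs'.inter ht'), ← integral_indicator hs', ← integral_indicator ht']
  have e : (s ∩ t).indicator (fun ω => F ω * G ω)
      = fun ω => s.indicator F ω * t.indicator G ω := by
    ext ω
    rw [Set.inter_indicator_mul]
  rw [e]
  exact IndepFun.integral_fun_mul_eq_mul_integral
    (indepFun_of_measurable h ((mem_space_iff.1 hF).indicator hs) ((mem_space_iff.1 hG).indicator ht))
    ((Lp.aestronglyMeasurable F).indicator hs') ((Lp.aestronglyMeasurable G).indicator ht')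

theorem norm_tensor {x z : Fields P} (h : Indep x.field z.field P) {F G : Lp ℝ 2 P}
    (hF : F ∈ x.space) (hG : G ∈ z.space) :
    ‖tensor F G‖ = ‖F‖ * ‖G‖ := by
  have hn : ∀ ψ : Lp ℝ 2 P, ‖ψ‖ ^ 2 = ∫ ω, ψ ω ^ 2 ∂P := fun ψ => by
    rw [← real_inner_self_eq_norm_sq, L2.inner_def]
    simp [pow_two]
  have e : ‖tensor F G‖ ^ 2 = (‖F‖ * ‖G‖) ^ 2 := by
    rw [mul_pow, hn, hn, hn, ← IndepFun.integral_fun_mul_eq_mul_integral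
      (indepFun_of_measurable h ((mem_space_iff.1 hF).pow_const 2)
        ((mem_space_iff.1 hG).pow_const 2))
      (Lp.memLp F).integrable_sq.aestronglyMeasurable
      (Lp.memLp G).integrable_sq.aestronglyMeasurable]
    refine integral_congr_ae ((tensor_ae_eq h hF hG).mono fun ω hω => ?_)
    simp only [hω, mul_pow]
  exact (pow_left_inj₀ (norm_nonneg _) (by positivity) two_ne_zero).1 e

theorem tensor_sub {x z : Fields P} (h : Indep x.field z.field P)
    {F G G' : Lp ℝ 2 P} (hF : F ∈ x.space) (hG : G ∈ z.space) (hG' : G' ∈ z.space) :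
    tensor F (G - G') = tensor F G - tensor F G' := by
  apply Lp.ext
  filter_upwards [tensor_ae_eq h hF hG, tensor_ae_eq h hF hG', tensor_ae_eq h hF (sub_mem hG hG'),
    Lp.coeFn_sub G G', Lp.coeFn_sub (tensor F G) (tensor F G')] with ω h1 h2 h3 h4 h5
  rw [h3, h5, Pi.sub_apply, h1, h2, h4, Pi.sub_apply, mul_sub]

theorem tensor_tendsto {x z : Fields P} (h : Indep x.field z.field P)
    {ι : Type*} {l : Filter ι} {F G' : Lp ℝ 2 P} {G : ι → Lp ℝ 2 P}
    (hF : F ∈ x.space) (hG : ∀ i, G i ∈ z.space) (hG' : G' ∈ z.space) (hl : Tendsto G l (𝓝 G')) :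
    Tendsto (fun i => tensor F (G i)) l (𝓝 (tensor F G')) := by
  rw [tendsto_iff_norm_sub_tendsto_zero] at hl ⊢
  have := hl.const_mul ‖F‖
  rw [mul_zero] at this
  refine this.congr fun i => ?_
  rw [← tensor_sub h hF (hG i) hG', norm_tensor h hF (sub_mem (hG i) hG')]

/-! ### Indicators and uniqueness from integrals -/

section Probability

variable [IsProbabilityMeasure P]

/-- The indicator function of an event, as an element of `L₂`. -/
noncomputable def ind (P : Measure Ω) [IsProbabilityMeasure P] (s : Set Ω)
    (hs : MeasurableSet[m0] s) : Lp ℝ 2 P :=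
  indicatorConstLp 2 hs (measure_ne_top P s) 1

theorem ind_ae_eq {s : Set Ω} (hs : MeasurableSet[m0] s) :
    ind P s hs =ᵐ[P] s.indicator fun _ => (1 : ℝ) := indicatorConstLp_coeFn

theorem ind_mem_space {x : Fields P} {s : Set Ω} (hs : MeasurableSet[x.field] s) :
    ind P s (x.field_le s hs) ∈ x.space :=
  mem_space_of_ae_eq (measurable_const.indicator hs) (ind_ae_eq _)

theorem inner_ind {s : Set Ω} (hs : MeasurableSet[m0] s) (ψ : Lp ℝ 2 P) :
    ⟪ind P s hs, ψ⟫_ℝ = ∫ ω in s, ψ ω ∂P :=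
  MeasureTheory.L2.inner_indicatorConstLp_one hs (measure_ne_top P s) ψ

theorem integrable_coe (ψ : Lp ℝ 2 P) : Integrable ψ P :=
  (Lp.memLp ψ).integrable (by norm_num)

theorem measurableSet_of_ind_mem {x : Fields P} {s : Set Ω} (hs : MeasurableSet[m0] s)
    (h : ind P s hs ∈ x.space) : MeasurableSet[x.field] s := by
  have h1 : Measurable[x.field] (s.indicator fun _ => (1 : ℝ)) :=
    measurable_of_ae_eq x (measurable_const.indicator hs) (mem_space_iff.1 h) (ind_ae_eq hs).symm
  have h2 := h1 (measurableSet_singleton (1 : ℝ))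
  convert h2 using 1
  ext ω
  by_cases hω : ω ∈ s <;> simp [hω]

theorem le_of_space_le {x y : Fields P} (h : x.space ≤ y.space) : x ≤ y := fun _ hs =>
  measurableSet_of_ind_mem (x.field_le _ hs) (h (ind_mem_space hs))

theorem Q_injective : Function.Injective (Q : Fields P → Lp ℝ 2 P → Lp ℝ 2 P) := by
  intro x y h
  have e : x.space = y.space := by
    ext ψ
    rw [← Q_eq_self_iff, ← Q_eq_self_iff, h]
  exact le_antisymm (le_of_space_le e.le) (le_of_space_le e.ge)

instance : T2Space (Fields P) :=
  (Topology.IsEmbedding.mk ⟨rfl⟩ Q_injective : Topology.IsEmbedding Q).t2Space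

/-- An `ℱ_x`-measurable element whose integrals over a π-system generating `ℱ_x` vanish is zero. -/
theorem eq_zero_of_setIntegral {x : Fields P} {S : Set (Set Ω)} (hS : IsPiSystem S)
    (hgen : x.field = MeasurableSpace.generateFrom S) {φ : Lp ℝ 2 P} (hφ : φ ∈ x.space)
    (huniv : ∫ ω, φ ω ∂P = 0) (h : ∀ s ∈ S, ∫ ω in s, φ ω ∂P = 0) : φ = 0 := by
  have key : ∀ s, MeasurableSet[x.field] s → ∫ ω in s, φ ω ∂P = 0 := by
    refine MeasurableSpace.induction_on_inter (C := fun s _ => ∫ ω in s, φ ω ∂P = 0) hgen hS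
      (by simp) h ?_ ?_
    · intro t ht h0
      have := integral_add_compl (x.field_le t ht) (integrable_coe φ)
      linarith
    · intro f hd hf h0
      rw [integral_iUnion (fun i => x.field_le _ (hf i)) hd (integrable_coe φ).integrableOn]
      simp [h0]
  have h2 : ⟪φ, φ⟫_ℝ = 0 := by
    have := lpMeas.ae_eq_zero_of_forall_setIntegral_eq_zero (𝕜 := ℝ) x.field_le (⟨φ, hφ⟩ :
      lpMeas ℝ ℝ x.field 2 P) (by norm_num) (by norm_num)
      (fun s _ _ => (integrable_coe φ).integrableOn) (fun s hs _ => key s hs)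
    have e : φ = 0 := Lp.ext (this.trans (Lp.coeFn_zero ℝ 2 P).symm)
    simp [e]
  exact inner_self_eq_zero.1 h2

theorem setIntegral_Q {x : Fields P} (ψ : Lp ℝ 2 P) {s : Set Ω} (hs : MeasurableSet[x.field] s) :
    ∫ ω in s, x.Q ψ ω ∂P = ∫ ω in s, ψ ω ∂P := by
  rw [← inner_ind (x.field_le s hs), ← inner_ind (x.field_le s hs), Q,
    ← inner_condExpL2_left_eq_right]
  congr 1
  exact Q_eq_self_iff.2 (ind_mem_space hs)

/-- To identify `Q_x ψ` it suffices to compare integrals over a π-system generating `ℱ_x`. -/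
theorem Q_eq_of_setIntegral {x : Fields P} {S : Set (Set Ω)} (hS : IsPiSystem S)
    (hgen : x.field = MeasurableSpace.generateFrom S) {φ ψ : Lp ℝ 2 P} (hφ : φ ∈ x.space)
    (huniv : ∫ ω, φ ω ∂P = ∫ ω, ψ ω ∂P)
    (h : ∀ s ∈ S, ∫ ω in s, φ ω ∂P = ∫ ω in s, ψ ω ∂P) : x.Q ψ = φ := by
  have hsub : ∀ s : Set Ω, ∫ ω in s, (x.Q ψ - φ : Lp ℝ 2 P) ω ∂P
      = ∫ ω in s, x.Q ψ ω ∂P - ∫ ω in s, φ ω ∂P := by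
    intro s
    rw [← integral_sub (integrable_coe _).integrableOn (integrable_coe _).integrableOn]
    exact integral_congr_ae (ae_restrict_of_ae (Lp.coeFn_sub _ _))
  refine sub_eq_zero.1 (eq_zero_of_setIntegral hS hgen (sub_mem (Q_mem x ψ) hφ) ?_ ?_)
  · rw [← setIntegral_univ, hsub, setIntegral_Q _ MeasurableSet.univ, setIntegral_univ,
      setIntegral_univ, huniv, sub_self]
  · intro s hs
    rw [hsub, setIntegral_Q _ (hgen ▸ MeasurableSpace.measurableSet_generateFrom hs), h s hs,
      sub_self]

/-! ### Commuting projections -/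

theorem Q_eq_of_forall_setIntegral {x : Fields P} {φ ψ : Lp ℝ 2 P} (hφ : φ ∈ x.space)
    (h : ∀ s, MeasurableSet[x.field] s → ∫ ω in s, φ ω ∂P = ∫ ω in s, ψ ω ∂P) : x.Q ψ = φ :=
  Q_eq_of_setIntegral (@MeasurableSpace.isPiSystem_measurableSet Ω x.field)
    (@MeasurableSpace.generateFrom_measurableSet Ω x.field).symm hφ
    (by simpa using h _ MeasurableSet.univ) h

theorem Q_Q_of_le {x y : Fields P} (h : x ≤ y) (ψ : Lp ℝ 2 P) : x.Q (y.Q ψ) = x.Q ψ := by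
  refine Q_eq_of_forall_setIntegral (Q_mem _ _) fun s hs => ?_
  rw [setIntegral_Q _ hs, setIntegral_Q _ (h s hs)]

theorem commuting_of_le {x y : Fields P} (h : x ≤ y) : Commuting x y := fun ψ => by
  rw [Q_Q_of_le h, Q_Q_of_ge h]

theorem Commuting.Q_Q {x y : Fields P} (h : Commuting x y) (ψ : Lp ℝ 2 P) :
    x.Q (y.Q ψ) = (x ⊓ y).Q ψ := by
  symm
  refine Q_eq_of_forall_setIntegral ?_ fun s hs => ?_
  · rw [space_inf]
    refine ⟨Q_mem _ _, ?_⟩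
    rw [h ψ]
    exact Q_mem _ _
  · rw [setIntegral_Q _ hs.1, setIntegral_Q _ hs.2]

theorem Commuting.inf_inf {a b x : Fields P} (hab : Commuting a b) (hax : Commuting a x)
    (hbx : Commuting b x) : Commuting (a ⊓ x) (b ⊓ x) := fun ψ => by
  rw [← hax.Q_Q, ← hbx.Q_Q, ← hbx.Q_Q, ← hax.Q_Q, ← hbx, ← hax, hab]

theorem ind_univ_ae_eq : ind P Set.univ MeasurableSet.univ =ᵐ[P] fun _ => (1 : ℝ) := by
  simpa using ind_ae_eq (P := P) MeasurableSet.univ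

/-- The projection for the trivial σ-field is the expectation. -/
theorem Q_bot (ψ : Lp ℝ 2 P) :
    (⊥ : Fields P).Q ψ = (∫ ω, ψ ω ∂P) • ind P Set.univ MeasurableSet.univ := by
  refine Q_eq_of_setIntegral (S := {s | MeasurableSet[m0] s ∧ P s = 0}) ?_ rfl
    (Submodule.smul_mem _ _ (ind_mem_space (x := ⊥) MeasurableSet.univ)) ?_ ?_
  · exact fun s hs t ht _ => ⟨hs.1.inter ht.1, measure_mono_null Set.inter_subset_left hs.2⟩
  · have e : ((∫ ω, ψ ω ∂P) • ind P Set.univ MeasurableSet.univ : Lp ℝ 2 P) =ᵐ[P]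
        fun _ => ∫ ω, ψ ω ∂P := by
      filter_upwards [Lp.coeFn_smul (∫ ω, ψ ω ∂P) (ind P Set.univ MeasurableSet.univ),
        ind_univ_ae_eq (P := P)] with ω h1 h2
      simp [h1, h2]
    rw [integral_congr_ae e]
    simp
  · intro s hs
    rw [setIntegral_measure_zero _ hs.2, setIntegral_measure_zero _ hs.2]

theorem integral_ind {s : Set Ω} (hs : MeasurableSet[m0] s) :
    ∫ ω, ind P s hs ω ∂P = P.real s := by
  rw [integral_congr_ae (ind_ae_eq hs), integral_indicator_const _ hs, smul_eq_mul, mul_one]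

/-- Commuting σ-fields with trivial intersection are independent. -/
theorem Commuting.indep {x y : Fields P} (h : Commuting x y) (hxy : x ⊓ y = ⊥) :
    Indep x.field y.field P := by
  rw [Indep_iff]
  intro s t hs ht
  have hs' := x.field_le s hs
  have ht' := y.field_le t ht
  have e1 : ∫ ω in s, ind P t ht' ω ∂P = P.real (s ∩ t) := by
    rw [integral_congr_ae (ae_restrict_of_ae (ind_ae_eq ht')), setIntegral_indicator ht']
    simp
  have e2 : ∫ ω in s, ind P t ht' ω ∂P = P.real s * P.real t := by
    have h1 : ind P t ht' = y.Q (ind P t ht') := (Q_eq_self_iff.2 (ind_mem_space ht)).symm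
    rw [h1, ← setIntegral_Q _ hs, h.Q_Q, hxy, Q_bot, ← inner_ind hs', inner_smul_right,
      real_inner_comm, inner_ind, setIntegral_univ, integral_ind, integral_ind, mul_comm]
  have e3 := e1.symm.trans e2
  rw [measureReal_def, measureReal_def, measureReal_def, ← ENNReal.toReal_mul] at e3
  exact (ENNReal.toReal_eq_toReal_iff' (measure_ne_top _ _)
    (ENNReal.mul_ne_top (measure_ne_top _ _) (measure_ne_top _ _))).1 e3

/-! ### Projections on products -/

theorem ind_inter {x z : Fields P} (h : Indep x.field z.field P)
    {s t : Set Ω} (hs : MeasurableSet[x.field] s) (ht : MeasurableSet[z.field] t) :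
    ind P (s ∩ t) ((x.field_le s hs).inter (z.field_le t ht)) =
      tensor (ind P s (x.field_le s hs)) (ind P t (z.field_le t ht)) := by
  apply Lp.ext
  filter_upwards [tensor_ae_eq h (ind_mem_space hs) (ind_mem_space ht),
    ind_ae_eq (P := P) (x.field_le s hs), ind_ae_eq (P := P) (z.field_le t ht),
    ind_ae_eq (P := P) ((x.field_le s hs).inter (z.field_le t ht))] with ω h1 h2 h3 h4
  rw [h1, h2, h3, h4]
  by_cases hω : ω ∈ s <;> by_cases hω' : ω ∈ t <;> simp [hω, hω']

/-- The events `s ∩ t` with `s ∈ m₁` and `t ∈ m₂` form a π-system. -/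
theorem isPiSystem_inter (m₁ m₂ : MeasurableSpace Ω) :
    IsPiSystem (Set.image2 (· ∩ ·) {s | MeasurableSet[m₁] s} {t | MeasurableSet[m₂] t}) := by
  rintro _ ⟨s, hs, t, ht, rfl⟩ _ ⟨s', hs', t', ht', rfl⟩ _
  exact ⟨s ∩ s', MeasurableSet.inter hs hs', t ∩ t', MeasurableSet.inter ht ht',
    by simp only [Set.inter_inter_inter_comm]⟩

theorem generateFrom_inter (m₁ m₂ : MeasurableSpace Ω) :
    m₁ ⊔ m₂ = MeasurableSpace.generateFrom
      (Set.image2 (· ∩ ·) {s | MeasurableSet[m₁] s} {t | MeasurableSet[m₂] t}) := by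
  refine le_antisymm (sup_le (fun s hs => ?_) fun t ht => ?_) (MeasurableSpace.generateFrom_le ?_)
  · exact MeasurableSpace.measurableSet_generateFrom ⟨s, hs, Set.univ, MeasurableSet.univ, by simp⟩
  · exact MeasurableSpace.measurableSet_generateFrom ⟨Set.univ, MeasurableSet.univ, t, ht, by simp⟩
  · rintro _ ⟨s, hs, t, ht, rfl⟩
    exact MeasurableSet.inter ((le_sup_left : m₁ ≤ m₁ ⊔ m₂) s hs)
      ((le_sup_right : m₂ ≤ m₁ ⊔ m₂) t ht)

/-- The projection onto a join of parts of two independent σ-fields acts factorwise on products. -/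
theorem Q_tensor {x z a c : Fields P} (h : Indep x.field z.field P) (ha : a ≤ x) (hc : c ≤ z)
    {F G : Lp ℝ 2 P} (hF : F ∈ x.space) (hG : G ∈ z.space) :
    (a ⊔ c).Q (tensor F G) = tensor (a.Q F) (c.Q G) := by
  have hF' := space_mono ha (Q_mem a F)
  have hG' := space_mono hc (Q_mem c G)
  have key : ∀ s t, MeasurableSet[a.field] s → MeasurableSet[c.field] t →
      ∫ ω in s ∩ t, tensor (a.Q F) (c.Q G) ω ∂P = ∫ ω in s ∩ t, tensor F G ω ∂P := by
    intro s t hs ht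
    rw [setIntegral_tensor h hF' hG' (ha s hs) (hc t ht),
      setIntegral_tensor h hF hG (ha s hs) (hc t ht), setIntegral_Q _ hs, setIntegral_Q _ ht]
  refine Q_eq_of_setIntegral (isPiSystem_inter a.field c.field)
    ((field_sup a c).trans (generateFrom_inter _ _)) ?_ ?_ ?_
  · refine mem_space_of_ae_eq (Measurable.mul ?_ ?_) (tensor_ae_eq h hF' hG')
    · exact (mem_space_iff.1 (Q_mem a F)).mono ((le_iff _ _).1 le_sup_left) le_rfl
    · exact (mem_space_iff.1 (Q_mem c G)).mono ((le_iff _ _).1 le_sup_right) le_rfl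
  · simpa using key Set.univ Set.univ MeasurableSet.univ MeasurableSet.univ
  · rintro _ ⟨s, hs, t, ht, rfl⟩
    exact key s t hs ht

/-! ### Convergence of projections -/

/-- Contractions of `L₂` that converge on the indicators of a generating π-system converge
strongly. -/
theorem tendsto_of_tendsto_ind {S : Set (Set Ω)} (hS : IsPiSystem S)
    (hgen : m0 = MeasurableSpace.generateFrom S) (huniv : Set.univ ∈ S) {ι : Type*} {l : Filter ι}
    {T : ι → Lp ℝ 2 P →L[ℝ] Lp ℝ 2 P} {T' : Lp ℝ 2 P →L[ℝ] Lp ℝ 2 P}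
    (hT : ∀ i ψ, ‖T i ψ‖ ≤ ‖ψ‖)
    (h : ∀ s ∈ S, ∀ hs : MeasurableSet[m0] s,
      Tendsto (fun i => T i (ind P s hs)) l (𝓝 (T' (ind P s hs)))) (ψ : Lp ℝ 2 P) :
    Tendsto (fun i => T i ψ) l (𝓝 (T' ψ)) := by
  let V : Submodule ℝ (Lp ℝ 2 P) :=
    { carrier := {ψ | Tendsto (fun i => T i ψ) l (𝓝 (T' ψ))}
      add_mem' := fun {φ ψ} hφ hψ => by simpa using hφ.add hψ
      zero_mem' := by simpa using tendsto_const_nhds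
      smul_mem' := fun c φ hφ => by simpa using hφ.const_smul c }
  have hlip : ∀ i, LipschitzWith 1 (T i) := fun i =>
    LipschitzWith.of_dist_le_mul fun φ ψ => by
      rw [dist_eq_norm, dist_eq_norm, ← map_sub, NNReal.coe_one, one_mul]
      exact hT i _
  have hclosed : IsClosed (V : Set (Lp ℝ 2 P)) :=
    (LipschitzWith.uniformEquicontinuous _ 1 hlip).equicontinuous.isClosed_setOfPred_tendsto
      T'.continuous
  -- `V` is dense: an element orthogonal to the indicators has zero integral over each event of `S`.
  have hperp : Vᗮ = ⊥ := by
    rw [Submodule.eq_bot_iff]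
    intro φ hφ
    have h0 : ∀ s ∈ S, ∫ ω in s, φ ω ∂P = 0 := fun s hs => by
      have hs' : MeasurableSet[m0] s := by
        rw [hgen]
        exact MeasurableSpace.measurableSet_generateFrom hs
      rw [← inner_ind hs']
      exact hφ _ (h s hs hs')
    refine eq_zero_of_setIntegral (x := ⊤) hS hgen
      (mem_space_iff.2 (Lp.stronglyMeasurable φ).measurable) ?_ h0
    simpa using h0 _ huniv
  have hmem : ψ ∈ V.topologicalClosure := by
    rw [Submodule.topologicalClosure_eq_top_iff.2 hperp]
    trivial
  rwa [hclosed.submodule_topologicalClosure_eq] at hmem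

/-- If `u_m` increases and is independent of `z`, and these σ-fields generate everything, then
contractions that converge on the products `F ⊗ G`, with `F` measurable with respect to some `u_m`
and `G` measurable with respect to `z`, converge strongly. -/
theorem tendsto_of_tendsto_tensor {u : ℕ → Fields P} (hu : Monotone u) {z : Fields P}
    (htop : (⨆ n, u n) ⊔ z = ⊤) (hind : ∀ n, Indep (u n).field z.field P) {ι : Type*} {l : Filter ι}
    {T : ι → Lp ℝ 2 P →L[ℝ] Lp ℝ 2 P} {T' : Lp ℝ 2 P →L[ℝ] Lp ℝ 2 P}
    (hT : ∀ i ψ, ‖T i ψ‖ ≤ ‖ψ‖)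
    (h : ∀ m, ∀ F ∈ (u m).space, ∀ G ∈ z.space,
      Tendsto (fun i => T i (tensor F G)) l (𝓝 (T' (tensor F G)))) (ψ : Lp ℝ 2 P) :
    Tendsto (fun i => T i ψ) l (𝓝 (T' ψ)) := by
  let S : Set (Set Ω) := ⋃ n, Set.image2 (· ∩ ·)
    {s | MeasurableSet[(u n).field] s} {t | MeasurableSet[z.field] t}
  have hS : IsPiSystem S := isPiSystem_iUnion_of_monotone _
    (fun n => isPiSystem_inter _ _)
    fun i j hij => Set.image2_subset_right fun s hs => (le_iff _ _).1 (hu hij) s hs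
  have hgen : m0 = MeasurableSpace.generateFrom S := by
    rw [← MeasurableSpace.iSup_generateFrom]
    simp_rw [← generateFrom_inter]
    have e := congrArg field htop
    rw [field_sup, field_iSup, iSup_sup, field_top] at e
    exact e.symm
  refine tendsto_of_tendsto_ind hS hgen ?_ hT ?_ ψ
  · exact Set.mem_iUnion.2 ⟨0, Set.univ, MeasurableSet.univ, Set.univ, MeasurableSet.univ, by simp⟩
  · intro s hs
    obtain ⟨n, a, ha, b, hb, rfl⟩ := Set.mem_iUnion.1 hs
    intro hs'
    rw [ind_inter (hind n) ha hb]
    exact h n _ (ind_mem_space ha) _ (ind_mem_space hb)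

/-- The martingale convergence theorem in `L₂`. -/
theorem tendsto_atTop_iSup {u : ℕ → Fields P} (hu : Monotone u) :
    Tendsto u atTop (𝓝 (⨆ n, u n)) := by
  rw [tendsto_iff]
  intro ψ
  have hle : (⨆ n, (u n).space).topologicalClosure ≤ (⨆ n, u n).space :=
    Submodule.topologicalClosure_minimal _ (iSup_le fun n => space_mono (le_iSup u n))
      (completeSpace_coe_iff_isComplete.1
        (inferInstance : CompleteSpace (⨆ n, u n).space)).isClosed
  have hgen : (⨆ n, u n).field =
      MeasurableSpace.generateFrom (⋃ n, {s | MeasurableSet[(u n).field] s}) := by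
    rw [field_iSup, ← MeasurableSpace.iSup_generateFrom]
    exact iSup_congr fun n => (@MeasurableSpace.generateFrom_measurableSet Ω (u n).field).symm
  have heq : (⨆ n, (u n).space).topologicalClosure = (⨆ n, u n).space := by
    have h0 : (⨆ n, (u n).space).topologicalClosureᗮ ⊓ (⨆ n, u n).space = ⊥ := by
      rw [Submodule.eq_bot_iff]
      rintro φ ⟨hφ, hφ'⟩
      rw [Submodule.orthogonal_closure] at hφ
      have h1 : ∀ n s, MeasurableSet[(u n).field] s → ∫ ω in s, φ ω ∂P = 0 := fun n s hs => by
        rw [← inner_ind ((u n).field_le s hs)]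
        exact hφ _ (Submodule.mem_iSup_of_mem n (ind_mem_space hs))
      refine eq_zero_of_setIntegral (isPiSystem_iUnion_of_monotone _
        (fun n => @MeasurableSpace.isPiSystem_measurableSet Ω (u n).field)
        fun i j hij s hs => (le_iff _ _).1 (hu hij) s hs) hgen hφ' ?_ ?_
      · simpa using h1 0 Set.univ MeasurableSet.univ
      · intro s hs
        obtain ⟨n, hn⟩ := Set.mem_iUnion.1 hs
        exact h1 n s hn
    have h2 := Submodule.sup_orthogonal_inf_of_hasOrthogonalProjection hle
    rwa [h0, sup_bot_eq] at h2
  have := Submodule.starProjection_tendsto_closure_iSup (fun n => (u n).space)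
    (fun i j hij => space_mono (hu hij)) ψ
  simp only [heq] at this
  exact this

/-! ### Joins of parts of two independent σ-fields -/

/-- Both sides act factorwise on the products `F ⊗ G`, which span `L₂`. -/
theorem Q_sup_Q_sup {x z a₁ a₂ c₁ c₂ : Fields P} (h : Indep x.field z.field P) (htop : x ⊔ z = ⊤)
    (ha₁ : a₁ ≤ x) (ha₂ : a₂ ≤ x) (hc₁ : c₁ ≤ z) (hc₂ : c₂ ≤ z) (ha : Commuting a₁ a₂)
    (hc : Commuting c₁ c₂) (ψ : Lp ℝ 2 P) :
    (a₁ ⊔ c₁).Q ((a₂ ⊔ c₂).Q ψ) = (a₁ ⊓ a₂ ⊔ c₁ ⊓ c₂).Q ψ := by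
  have key := tendsto_of_tendsto_tensor (l := (atTop : Filter ℕ)) (u := fun _ => x)
    monotone_const (z := z) (by simpa using htop) (fun _ => h)
    (T := fun _ => (a₁ ⊔ c₁).proj ∘L (a₂ ⊔ c₂).proj) (T' := (a₁ ⊓ a₂ ⊔ c₁ ⊓ c₂).proj)
    (fun _ ψ => (norm_Q_le _ _).trans (norm_Q_le _ _)) ?_ ψ
  · exact tendsto_nhds_unique tendsto_const_nhds key
  · intro _ F hF G hG
    have e : (a₁ ⊔ c₁).Q ((a₂ ⊔ c₂).Q (tensor F G)) = (a₁ ⊓ a₂ ⊔ c₁ ⊓ c₂).Q (tensor F G) := by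
      rw [Q_tensor h ha₂ hc₂ hF hG, Q_tensor h ha₁ hc₁ (space_mono ha₂ (Q_mem _ _))
        (space_mono hc₂ (Q_mem _ _)), Q_tensor h (inf_le_left.trans ha₁) (inf_le_left.trans hc₁)
        hF hG, ha.Q_Q, hc.Q_Q]
    exact tendsto_const_nhds.congr fun _ => e.symm

theorem commuting_sup {x z a₁ a₂ c₁ c₂ : Fields P} (h : Indep x.field z.field P)
    (htop : x ⊔ z = ⊤) (ha₁ : a₁ ≤ x) (ha₂ : a₂ ≤ x) (hc₁ : c₁ ≤ z) (hc₂ : c₂ ≤ z)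
    (ha : Commuting a₁ a₂) (hc : Commuting c₁ c₂) : Commuting (a₁ ⊔ c₁) (a₂ ⊔ c₂) := fun ψ => by
  rw [Q_sup_Q_sup h htop ha₁ ha₂ hc₁ hc₂ ha hc, Q_sup_Q_sup h htop ha₂ ha₁ hc₂ hc₁ ha.symm hc.symm,
    inf_comm a₁, inf_comm c₁]

/-- Meets of joins of parts of two independent σ-fields are computed componentwise. -/
theorem sup_inf_sup {x z a₁ a₂ c₁ c₂ : Fields P} (h : Indep x.field z.field P)
    (htop : x ⊔ z = ⊤) (ha₁ : a₁ ≤ x) (ha₂ : a₂ ≤ x) (hc₁ : c₁ ≤ z) (hc₂ : c₂ ≤ z)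
    (ha : Commuting a₁ a₂) (hc : Commuting c₁ c₂) :
    (a₁ ⊔ c₁) ⊓ (a₂ ⊔ c₂) = a₁ ⊓ a₂ ⊔ c₁ ⊓ c₂ := by
  apply Q_injective
  ext1 ψ
  rw [← (commuting_sup h htop ha₁ ha₂ hc₁ hc₂ ha hc).Q_Q, Q_sup_Q_sup h htop ha₁ ha₂ hc₁ hc₂ ha hc]

end Probability

end Fields

open Fields

variable {B : Set (Fields P)} {u : ℕ → Fields P} {x : Fields P}

/-! ### Increasing sequences in a noise-type Boolean algebra -/

section Order

theorem IsNoiseType.indep_compl (hB : IsNoiseType B) {x : Fields P} (hx : x ∈ B) :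
    Indep x.field (compl B x).field P :=
  hB.indep x hx _ (hB.compl_spec hx).1 (hB.compl_spec hx).2.1

theorem IsNoiseType.compl_anti (hB : IsNoiseType B) {x y : Fields P} (hx : x ∈ B) (hy : y ∈ B)
    (h : x ≤ y) : compl B y ≤ compl B x := by
  obtain ⟨hx', -, htop⟩ := hB.compl_spec hx
  obtain ⟨hy', hbot, -⟩ := hB.compl_spec hy
  have e := hB.distrib _ hy' x hx _ hx'
  have h0 : compl B y ⊓ x = ⊥ := le_bot_iff.1 (hbot ▸ le_inf (inf_le_right.trans h) inf_le_left)
  rw [htop, inf_top_eq, h0, bot_sup_eq] at e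
  exact e.le.trans inf_le_right

theorem IncreasesTo.le (hu : IncreasesTo B u x) (n : ℕ) : u n ≤ x := hu.2.2 ▸ le_iSup u n

theorem IncreasesTo.antitone_compl (hu : IncreasesTo B u x) (hB : IsNoiseType B) :
    Antitone fun n => compl B (u n) := fun i j hij =>
  hB.compl_anti (hu.1 i) (hu.1 j) (hu.2.1 hij)

theorem IncreasesTo.tendsto_compl (hu : IncreasesTo B u x) (hB : IsNoiseType B) :
    Tendsto (fun n => compl B (u n)) atTop (𝓝 (⨅ n, compl B (u n))) :=
  tendsto_atTop_iInf (hu.antitone_compl hB)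

theorem IncreasesTo.indep_iInf_compl (hu : IncreasesTo B u x) (hB : IsNoiseType B) (n : ℕ) :
    Indep (u n).field (⨅ n, compl B (u n)).field P :=
  indep_of_indep_of_le_right (hB.indep_compl (hu.1 n))
    ((le_iff _ _).1 (iInf_le (fun n => compl B (u n)) n))

/-- The complement of `x` in a noise-type extension of `B` is below the complement of every `u n`. -/
theorem IncreasesTo.sup_eq_top (hu : IncreasesTo B u x) (hB : IsNoiseType B)
    (hx : x ∈ completion B) : x ⊔ ⨅ n, compl B (u n) = ⊤ := by
  obtain ⟨D, ⟨hD, hBD, -⟩, hxD⟩ := Set.mem_sUnion.1 hx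
  have hle : compl D x ≤ ⨅ n, compl B (u n) := le_iInf fun n => by
    obtain ⟨h, h0, h1⟩ := hB.compl_spec (hu.1 n)
    rw [hD.eq_compl (hBD (hu.1 n)) (hBD h) h0 h1]
    exact hD.compl_anti (hBD (hu.1 n)) hxD (hu.le n)
  exact top_le_iff.1 ((hD.compl_spec hxD).2.2.ge.trans (sup_le_sup_left hle x))

end Order

variable [IsProbabilityMeasure P]

/-- Elements of a noise-type Boolean algebra have commuting projections: split `y` along `x` and `x'`,
and write `x = x ∨ 0`. -/
theorem IsNoiseType.commuting (hB : IsNoiseType B) {x y : Fields P} (hx : x ∈ B) (hy : y ∈ B) :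
    Commuting x y := by
  obtain ⟨hx', -, htop⟩ := hB.compl_spec hx
  have e : y = y ⊓ x ⊔ y ⊓ compl B x := by
    rw [← hB.distrib y hy x hx _ hx', htop, inf_top_eq]
  have := commuting_sup (hB.indep_compl hx) htop le_rfl (inf_le_right : y ⊓ x ≤ x) bot_le
    (inf_le_right : y ⊓ compl B x ≤ compl B x) (commuting_of_le inf_le_right).symm
    (commuting_of_le bot_le)
  rwa [← e, sup_bot_eq] at this

theorem IncreasesTo.tendsto (hu : IncreasesTo B u x) : Tendsto u atTop (𝓝 x) :=
  hu.2.2 ▸ tendsto_atTop_iSup hu.2.1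

theorem IncreasesTo.indep (hu : IncreasesTo B u x) (hB : IsNoiseType B) :
    Indep x.field (⨅ n, compl B (u n)).field P := by
  rw [← hu.2.2, field_iSup]
  exact indep_iSup_of_monotone (hu.indep_iInf_compl hB) (fun n => (u n).field_le)
    (field_le _) hu.2.1

theorem IncreasesTo.joinLimComplEqTop_iff (hu : IncreasesTo B u x) (hB : IsNoiseType B) :
    JoinLimComplEqTop B u x ↔ x ⊔ ⨅ n, compl B (u n) = ⊤ := by
  refine ⟨?_, fun h => ⟨_, hu.tendsto_compl hB, h⟩⟩
  rintro ⟨z, hz, h⟩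
  rwa [tendsto_nhds_unique (hu.tendsto_compl hB) hz]

theorem IncreasesTo.tendsto_sup_compl (hu : IncreasesTo B u x) (hB : IsNoiseType B) (m : ℕ) :
    Tendsto (fun n => u m ⊔ compl B (u n)) atTop (𝓝 (u m ⊔ ⨅ n, compl B (u n))) := by
  rw [← tendsto_add_atTop_iff_nat m, tendsto_iff]
  intro ψ
  have hi := hB.indep_compl (hu.1 m)
  have hle : ∀ n, compl B (u (n + m)) ≤ compl B (u m) := fun n =>
    hu.antitone_compl hB (Nat.le_add_left m n)
  refine tendsto_of_tendsto_tensor (u := fun _ => u m) monotone_const (z := compl B (u m))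
    (by simpa using (hB.compl_spec (hu.1 m)).2.2) (fun _ => hi)
    (T := fun n => (u m ⊔ compl B (u (n + m))).proj) (T' := (u m ⊔ ⨅ n, compl B (u n)).proj)
    (fun n ψ => norm_Q_le _ _) ?_ ψ
  intro _ F hF G hG
  simp only [proj_apply]
  simp_rw [fun n => Q_tensor hi le_rfl (hle n) hF hG]
  rw [Q_tensor hi le_rfl (iInf_le (fun n => compl B (u n)) m) hF hG]
  refine tensor_tendsto hi (Q_mem _ _) (fun n => space_mono (hle n) (Q_mem _ _))
    (space_mono (iInf_le (fun n => compl B (u n)) m) (Q_mem _ _)) ?_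
  have := (tendsto_iff _ _).1 (hu.tendsto_compl hB) G
  exact (tendsto_add_atTop_iff_nat m).2 this

theorem IncreasesTo.iteratedLimEqTop_iff (hu : IncreasesTo B u x) (hB : IsNoiseType B) :
    IteratedLimEqTop B u ↔ x ⊔ ⨅ n, compl B (u n) = ⊤ := by
  have hlim : Tendsto (fun m => u m ⊔ ⨅ n, compl B (u n)) atTop
      (𝓝 (x ⊔ ⨅ n, compl B (u n))) := by
    have h := tendsto_atTop_iSup (u := fun m => u m ⊔ ⨅ n, compl B (u n))
      fun i j hij => sup_le_sup_right (hu.2.1 hij) _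
    rwa [← iSup_sup, hu.2.2] at h
  constructor
  · rintro ⟨w, hw, hw'⟩
    have e : w = fun m => u m ⊔ ⨅ n, compl B (u n) :=
      funext fun m => tendsto_nhds_unique (hw m) (hu.tendsto_sup_compl hB m)
    exact tendsto_nhds_unique hlim (e ▸ hw')
  · exact fun h => ⟨_, hu.tendsto_sup_compl hB, h ▸ hlim⟩

/-! ### Adjoining the limit of an increasing sequence -/

theorem IncreasesTo.commuting (hu : IncreasesTo B u x) (hB : IsNoiseType B) {b : Fields P}
    (hb : b ∈ B) : Commuting b x :=
  commuting_of_tendsto (fun n => hB.commuting hb (hu.1 n)) hu.tendsto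

theorem IncreasesTo.commuting_iInf_compl (hu : IncreasesTo B u x) (hB : IsNoiseType B)
    {b : Fields P} (hb : b ∈ B) : Commuting b (⨅ n, compl B (u n)) :=
  commuting_of_tendsto (fun n => hB.commuting hb (hB.compl_spec (hu.1 n)).1) (hu.tendsto_compl hB)

/-- On `F ⊗ G`, with `F` measurable in `u_m` and `G` in the limit of the complements, both projections
give `Q_b F ⊗ Q_c G` as soon as `n ≥ m`. -/
theorem IncreasesTo.tendsto_split (hu : IncreasesTo B u x) (hB : IsNoiseType B)
    (htop : x ⊔ ⨅ n, compl B (u n) = ⊤) {b c : Fields P} (hb : b ∈ B) (hc : c ∈ B) :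
    Tendsto (fun n => b ⊓ u n ⊔ c ⊓ compl B (u n)) atTop
      (𝓝 (b ⊓ x ⊔ c ⊓ ⨅ n, compl B (u n))) := by
  rw [tendsto_iff]
  refine tendsto_of_tendsto_tensor hu.2.1 (hu.2.2.symm ▸ htop) (hu.indep_iInf_compl hB)
    (T := fun n => (b ⊓ u n ⊔ c ⊓ compl B (u n)).proj)
    (T' := (b ⊓ x ⊔ c ⊓ ⨅ n, compl B (u n)).proj) (fun n ψ => norm_Q_le _ _) ?_
  intro m F hF G hG
  refine tendsto_const_nhds.congr' ?_
  filter_upwards [eventually_ge_atTop m] with n hn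
  have hF' := space_mono (hu.2.1 hn) hF
  have hG' := space_mono (iInf_le (fun n => compl B (u n)) n) hG
  rw [proj_apply, proj_apply,
    Q_tensor (hB.indep_compl (hu.1 n)) inf_le_right inf_le_right hF' hG',
    Q_tensor (hu.indep hB) inf_le_right inf_le_right (space_mono (hu.le m) hF) hG,
    ← (hB.commuting hb (hu.1 n)).Q_Q, ← (hB.commuting hc (hB.compl_spec (hu.1 n)).1).Q_Q,
    ← (hu.commuting hB hb).Q_Q, ← (hu.commuting_iInf_compl hB hc).Q_Q,
    Q_eq_self_iff.2 hF', Q_eq_self_iff.2 hG', Q_eq_self_iff.2 hG,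
    Q_eq_self_iff.2 (space_mono (hu.le m) hF)]

theorem IncreasesTo.inf_sup_inf (hu : IncreasesTo B u x) (hB : IsNoiseType B)
    (htop : x ⊔ ⨅ n, compl B (u n) = ⊤) {b : Fields P} (hb : b ∈ B) :
    b ⊓ x ⊔ b ⊓ ⨅ n, compl B (u n) = b := by
  refine tendsto_nhds_unique (hu.tendsto_split hB htop hb hb)
    (tendsto_const_nhds.congr fun n => ?_)
  obtain ⟨h, -, ht⟩ := hB.compl_spec (hu.1 n)
  rw [← hB.distrib b hb _ (hu.1 n) _ h, ht, inf_top_eq]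

/-- The σ-fields `(b ∧ x) ∨ (c ∧ z)` with `b, c ∈ B`: the algebra generated by `B`, `x` and `z`
when `z` is a complement of `x`. -/
def adjoin (B : Set (Fields P)) (x z : Fields P) : Set (Fields P) :=
  Set.image2 (fun b c => b ⊓ x ⊔ c ⊓ z) B B

/-- A σ-field `x` with independent complement `z` can be adjoined to `B` if both commute with `B` and
each element of `B` splits along them. -/
theorem isNoiseType_adjoin (hB : IsNoiseType B) {x z : Fields P} (hi : Indep x.field z.field P)
    (htop : x ⊔ z = ⊤) (hx : ∀ b ∈ B, Commuting b x) (hz : ∀ b ∈ B, Commuting b z)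
    (hsplit : ∀ b ∈ B, b ⊓ x ⊔ b ⊓ z = b) : IsNoiseType (adjoin B x z) := by
  have hinf : ∀ b ∈ B, ∀ c ∈ B, ∀ b₂ ∈ B, ∀ c₂ ∈ B,
      (b ⊓ x ⊔ c ⊓ z) ⊓ (b₂ ⊓ x ⊔ c₂ ⊓ z) = b ⊓ b₂ ⊓ x ⊔ c ⊓ c₂ ⊓ z := by
    intro b hb c hc b₂ hb₂ c₂ hc₂
    rw [sup_inf_sup hi htop inf_le_right inf_le_right inf_le_right inf_le_right
      ((hB.commuting hb hb₂).inf_inf (hx b hb) (hx b₂ hb₂))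
      ((hB.commuting hc hc₂).inf_inf (hz c hc) (hz c₂ hc₂)), inf_inf_inf_comm, inf_idem,
      inf_inf_inf_comm, inf_idem]
  have hcomm : ∀ y ∈ adjoin B x z, ∀ w ∈ adjoin B x z, Commuting y w := by
    rintro _ ⟨b, hb, c, hc, rfl⟩ _ ⟨b₂, hb₂, c₂, hc₂, rfl⟩
    exact commuting_sup hi htop inf_le_right inf_le_right inf_le_right inf_le_right
      ((hB.commuting hb hb₂).inf_inf (hx b hb) (hx b₂ hb₂))
      ((hB.commuting hc hc₂).inf_inf (hz c hc) (hz c₂ hc₂))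
  -- The traces of `b ∨ c` on `x` and on `z` are read off from its splitting along them.
  have hdecomp : ∀ b ∈ B, ∀ c ∈ B, b ⊔ c = (b ⊓ x ⊔ c ⊓ x) ⊔ (b ⊓ z ⊔ c ⊓ z) := by
    intro b hb c hc
    rw [sup_sup_sup_comm, hsplit b hb, hsplit c hc]
  have hdx : ∀ b ∈ B, ∀ c ∈ B, (b ⊔ c) ⊓ x = b ⊓ x ⊔ c ⊓ x := by
    intro b hb c hc
    have hle : b ⊓ x ⊔ c ⊓ x ≤ x := sup_le inf_le_right inf_le_right
    have := sup_inf_sup hi htop hle le_rfl (sup_le inf_le_right inf_le_right : b ⊓ z ⊔ c ⊓ z ≤ z)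
      bot_le (commuting_of_le hle) (commuting_of_le bot_le).symm
    rwa [← hdecomp b hb c hc, sup_bot_eq, inf_bot_eq, sup_bot_eq, inf_eq_left.2 hle] at this
  have hdz : ∀ b ∈ B, ∀ c ∈ B, (b ⊔ c) ⊓ z = b ⊓ z ⊔ c ⊓ z := by
    intro b hb c hc
    have hle : b ⊓ z ⊔ c ⊓ z ≤ z := sup_le inf_le_right inf_le_right
    have := sup_inf_sup hi htop (sup_le inf_le_right inf_le_right : b ⊓ x ⊔ c ⊓ x ≤ x) bot_le hle
      le_rfl (commuting_of_le bot_le).symm (commuting_of_le hle)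
    rwa [← hdecomp b hb c hc, bot_sup_eq, inf_bot_eq, bot_sup_eq, inf_eq_left.2 hle] at this
  have hsup : ∀ b ∈ B, ∀ c ∈ B, ∀ b₂ ∈ B, ∀ c₂ ∈ B,
      (b ⊓ x ⊔ c ⊓ z) ⊔ (b₂ ⊓ x ⊔ c₂ ⊓ z) = (b ⊔ b₂) ⊓ x ⊔ (c ⊔ c₂) ⊓ z := by
    intro b hb c hc b₂ hb₂ c₂ hc₂
    rw [hdx b hb b₂ hb₂, hdz c hc c₂ hc₂, sup_sup_sup_comm]
  refine ⟨⟨⊥, hB.bot_mem, ⊥, hB.bot_mem, by simp⟩,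
    ⟨⊤, hB.top_mem, ⊤, hB.top_mem, by simpa using htop⟩, ?_, ?_, ?_, ?_, ?_⟩
  · rintro _ ⟨b, hb, c, hc, rfl⟩ _ ⟨b₂, hb₂, c₂, hc₂, rfl⟩
    exact ⟨_, hB.inf_mem b hb b₂ hb₂, _, hB.inf_mem c hc c₂ hc₂,
      (hinf b hb c hc b₂ hb₂ c₂ hc₂).symm⟩
  · rintro _ ⟨b, hb, c, hc, rfl⟩ _ ⟨b₂, hb₂, c₂, hc₂, rfl⟩
    exact ⟨_, hB.sup_mem b hb b₂ hb₂, _, hB.sup_mem c hc c₂ hc₂,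
      (hsup b hb c hc b₂ hb₂ c₂ hc₂).symm⟩
  · rintro _ ⟨b, hb, c, hc, rfl⟩ _ ⟨b₂, hb₂, c₂, hc₂, rfl⟩ _ ⟨b₃, hb₃, c₃, hc₃, rfl⟩
    simp only
    rw [hsup b₂ hb₂ c₂ hc₂ b₃ hb₃ c₃ hc₃, hinf b hb c hc _ (hB.sup_mem _ hb₂ _ hb₃) _
      (hB.sup_mem _ hc₂ _ hc₃), hinf b hb c hc b₂ hb₂ c₂ hc₂, hinf b hb c hc b₃ hb₃ c₃ hc₃,
      hsup _ (hB.inf_mem _ hb _ hb₂) _ (hB.inf_mem _ hc _ hc₂) _ (hB.inf_mem _ hb _ hb₃) _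
      (hB.inf_mem _ hc _ hc₃), hB.distrib b hb b₂ hb₂ b₃ hb₃, hB.distrib c hc c₂ hc₂ c₃ hc₃]
  · rintro _ ⟨b, hb, c, hc, rfl⟩
    obtain ⟨hb', hb0, hb1⟩ := hB.compl_spec hb
    obtain ⟨hc', hc0, hc1⟩ := hB.compl_spec hc
    refine ⟨_, ⟨_, hb', _, hc', rfl⟩, ?_, ?_⟩
    · simp only
      rw [hinf b hb c hc _ hb' _ hc', hb0, hc0]
      simp
    · simp only
      rw [hsup b hb c hc _ hb' _ hc', hb1, hc1, top_inf_eq, top_inf_eq, htop]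
  · exact fun y hy w hw h => (hcomm y hy w hw).indep h

theorem IncreasesTo.mem_completion (hu : IncreasesTo B u x) (hB : IsNoiseType B)
    (htop : x ⊔ ⨅ n, compl B (u n) = ⊤) : x ∈ completion B := by
  refine Set.mem_sUnion.2 ⟨adjoin B x (⨅ n, compl B (u n)), ⟨?_, ?_, ?_⟩, ?_⟩
  · exact isNoiseType_adjoin hB (hu.indep hB) htop (fun b hb => hu.commuting hB hb)
      (fun b hb => hu.commuting_iInf_compl hB hb) (fun b hb => hu.inf_sup_inf hB htop hb)
  · exact fun b hb => ⟨b, hb, b, hb, hu.inf_sup_inf hB htop hb⟩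
  · rintro _ ⟨b, hb, c, hc, rfl⟩
    refine mem_closure_of_tendsto (hu.tendsto_split hB htop hb hc) (Eventually.of_forall fun n => ?_)
    exact hB.sup_mem _ (hB.inf_mem _ hb _ (hu.1 n)) _
      (hB.inf_mem _ hc _ (hB.compl_spec (hu.1 n)).1)
  · exact ⟨⊤, hB.top_mem, ⊥, hB.bot_mem, by simp⟩

end Noise

theorem proposition3p1 {Ω : Type*} {m0 : MeasurableSpace Ω} (P : Measure Ω)
    [IsProbabilityMeasure P] (B : Set (Noise.Fields P)) (hB : Noise.IsNoiseType B)
    (x : Noise.Fields P) (hx : ∃ u, Noise.IncreasesTo B u x) :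
    List.TFAE
      [x ∈ Noise.completion B,
       ∃ u, Noise.IncreasesTo B u x ∧ Noise.JoinLimComplEqTop B u x,
       ∀ u, Noise.IncreasesTo B u x → Noise.JoinLimComplEqTop B u x,
       ∃ u, Noise.IncreasesTo B u x ∧ Noise.IteratedLimEqTop B u,
       ∀ u, Noise.IncreasesTo B u x → Noise.IteratedLimEqTop B u] := by
  tfae_have 1 → 3 := fun h u hu => (hu.joinLimComplEqTop_iff hB).2 (hu.sup_eq_top hB h)
  tfae_have 1 → 5 := fun h u hu => (hu.iteratedLimEqTop_iff hB).2 (hu.sup_eq_top hB h)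
  tfae_have 3 → 2 := fun h => hx.imp fun u hu => ⟨hu, h u hu⟩
  tfae_have 5 → 4 := fun h => hx.imp fun u hu => ⟨hu, h u hu⟩
  tfae_have 2 → 1 := fun ⟨u, hu, h⟩ => hu.mem_completion hB ((hu.joinLimComplEqTop_iff hB).1 h)
  tfae_have 4 → 1 := fun ⟨u, hu, h⟩ => hu.mem_completion hB ((hu.iteratedLimEqTop_iff hB).1 h)
  tfae_finish
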